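/- Let $A$ be a finite alphabet and let $(Q,A,q_I,\delta)$ be a deterministic finite automaton, i.e. $Q$ is a finite set of states, $q_I\in Q$ is the initial state and $\delta:Q\times A\to Q$ is the transition function. Let $\mu:A\to(0,1]$ satisfy $\sum_{a\in A}\mu(a)=1$ (a positive Bernoulli measure), and for a finite word $w=a_1\cdots a_k$ put $\mu(w)=\prod_{j=1}^k\mu(a_j)$ (so the empty word has $\mu(w)=1$). A sequence $X=X(0)X(1)X(2)\cdots\in A^\omega$ is called $\mu$-normal if for every finite word $w$ over $A$, with $k=|w|$, \[ \lim_{n\to\infty}\frac{\#\{i: 0\le i\le n-k,\ X(i)\cdots X(i+k-1)=w\}}{n-k+1}=\mu(w). \] For $X\in A^\omega$ let $q_0=q_I$ and $q_{i+1}=\delta(q_i,X(i))$ be the run of the automaton on $X$, and for $q\in Q$ let $V_q(n,X)=\#\{i: 0\le i\le n,\ q_i=q\}$ be the number of visits to $q$ during the run on the first $n$ letters of $X$. Then for every $q\in Q$ there exists a real number $\pi_q\ge 0$ such that for every $\mu$-normal sequence $X\in A^\omega$, one of the following holds: (a) $n\mapsto V_q(n,X)$ is ultimately constant, i.e. $q$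 is visited only finitely often during the run on $X$; or (b) $\lim_{n\to\infty} V_q(n,X)/n=\pi_q$ and $\pi_q>0$. -/

import Mathlib

/-- A deterministic automaton with states `Q` over the alphabet `A`: an initial state and a
transition function (runs are infinite, so there are no final states). -/
structure DetAutomaton (Q A : Type*) where
  start : Q
  step : Q → A → Q

/-- The extension of the transition function to words, read from left to right. -/
def DetAutomaton.stepWord {Q A : Type*} (M : DetAutomaton Q A) (q : Q) (w : List A) : Q :=
  w.foldl M.step q

/-- The word made of the first `n` letters of the infinite sequence `X`. -/
def seqPrefix {A : Type*} (X : ℕ → A) (n : ℕ) : List A :=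
  List.ofFn (fun i : Fin n => X i)

open Classical in
/-- The number of (possibly overlapping) occurrences of `u` as a factor of `w`. -/
noncomputable def nbOcc {A : Type*} (u w : List A) : ℕ :=
  ((Finset.range (w.length + 1)).filter
    (fun i => i + u.length ≤ w.length ∧ (w.drop i).take u.length = u)).card

/-- The frequency of occurrence of `u` in `w` (meaningful when `u` is not longer than `w`). -/
noncomputable def wordFreq {A : Type*} (u w : List A) : ℝ :=
  (nbOcc u w : ℝ) / ((w.length : ℝ) - (u.length : ℝ) + 1)

/-- The infinite sequence `X` has asymptotic frequency `c` of occurrences of `u`. -/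
def HasFreq {A : Type*} (u : List A) (X : ℕ → A) (c : ℝ) : Prop :=
  Filter.Tendsto (fun n : ℕ => wordFreq u (seqPrefix X (n + 1))) Filter.atTop (nhds c)

/-- The probability of the word `w` when letters are independent with distribution `μ`. -/
def wordProb {A : Type*} (μ : A → ℝ) (w : List A) : ℝ :=
  (w.map μ).prod

/-- `μ`-normality: every word occurs in `X` with asymptotic frequency its `μ`-probability. -/
def IsNormalSeq {A : Type*} (μ : A → ℝ) (X : ℕ → A) : Prop :=
  ∀ w : List A, HasFreq w X (wordProb μ w)

open Classical in
/-- The number of times `q` is visited by the run of `M` on the first `n` letters of `X`,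
that is, among the `n + 1` states reached after reading `0, 1, …, n` letters. -/
noncomputable def DetAutomaton.visits {Q A : Type*} (M : DetAutomaton Q A) (q : Q)
    (n : ℕ) (X : ℕ → A) : ℕ :=
  ((Finset.range (n + 1)).filter (fun i => M.stepWord M.start (seqPrefix X i) = q)).card

open Filter Topology

/-! Split on whether `q` is recurrent. If it is not, some word leads from `q` to a state with no
return; chaining such escapes gives one word after which `q` is unreachable from every state, and a
normal sequence contains that word (`finite_visits_of_transient`).

If `q` is recurrent, its class is closed and irreducible, and `exists_poisson` solves `h - P h = 1_q
- c` there with `c > 0`, where `P` is the transition operator; this `c` is the frequency. The sums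
of `f = 1_q - c` along a random word of length `L` are then a martingale up to a bounded term, so
their mean absolute value is of order `√L` (`exists_wordExp_abs_runSum_le`).

Normality controls the letters of a window, not the state in which the run enters it. Summing the
absolute deviation over all entry states of the class bounds it by a function of the window alone,
whose average converges by `tendsto_average`; small window sums then force the average of `f` along
the run to zero. -/

/-- The factor of length `k` of `X` starting at position `i`. -/
def window {A : Type*} (X : ℕ → A) : ℕ → ℕ → List A
  | _, 0 => []
  | i, k + 1 => X i :: window X (i + 1) k

/-- The expectation of `F` over words of length `L` with independent `μ`-distributed letters. -/
noncomputable def wordExp {A : Type*} [Fintype A] (μ : A → ℝ) : ℕ → (List A → ℝ) → ℝ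
  | 0, F => F []
  | L + 1, F => ∑ a, μ a * wordExp μ L (fun w => F (a :: w))

/-- The sum of `f` along the run from `p` on a word, the last state excluded. -/
def DetAutomaton.runSum {Q A : Type*} (M : DetAutomaton Q A) (f : Q → ℝ) : Q → List A → ℝ
  | _, [] => 0
  | p, a :: w => f p + M.runSum f (M.step p a) w

/-- The state reached after reading the first `i` letters of `X`. -/
def DetAutomaton.run {Q A : Type*} (M : DetAutomaton Q A) (X : ℕ → A) (i : ℕ) : Q :=
  M.stepWord M.start (seqPrefix X i)

/-! ### Windows, prefixes and occurrence counts -/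

section Window

variable {A : Type*} (X : ℕ → A)

lemma window_length (i k : ℕ) : (window X i k).length = k := by
  induction k generalizing i with
  | zero => rfl
  | succ k ih => simp [window, ih]

lemma window_succ' (i k : ℕ) : window X i (k + 1) = window X i k ++ [X (i + k)] := by
  induction k generalizing i with
  | zero => simp [window]
  | succ k ih =>
    rw [window, ih (i + 1), window]
    simp [show i + 1 + k = i + (k + 1) by ring]

lemma seqPrefix_succ (n : ℕ) : seqPrefix X (n + 1) = seqPrefix X n ++ [X n] := by
  rw [seqPrefix, List.ofFn_succ', List.concat_eq_append]
  simp [seqPrefix]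

lemma seqPrefix_add (i k : ℕ) : seqPrefix X (i + k) = seqPrefix X i ++ window X i k := by
  induction k with
  | zero => simp [window]
  | succ k ih => rw [← add_assoc, seqPrefix_succ, ih, window_succ', List.append_assoc]

lemma seqPrefix_length (n : ℕ) : (seqPrefix X n).length = n := by simp [seqPrefix]

lemma take_drop_seqPrefix {i k n : ℕ} (h : i + k ≤ n) :
    ((seqPrefix X n).drop i).take k = window X i k := by
  obtain ⟨d, rfl⟩ := Nat.exists_eq_add_of_le h
  rw [seqPrefix_add, seqPrefix_add, List.append_assoc,
    List.drop_append_of_le_length (by simp [seqPrefix_length]),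
    List.drop_of_length_le (by simp [seqPrefix_length]), List.nil_append,
    List.take_append_of_le_length (by simp [window_length]),
    List.take_of_length_le (by simp [window_length])]

open Classical in
lemma nbOcc_seqPrefix (u : List A) (m : ℕ) :
    (nbOcc u (seqPrefix X (m + u.length)) : ℝ)
      = ∑ i ∈ Finset.range (m + 1), if window X i u.length = u then (1 : ℝ) else 0 := by
  rw [← Finset.sum_filter, Finset.sum_const, nsmul_eq_mul, mul_one, nbOcc]
  congr 2
  ext i
  simp only [Finset.mem_filter, Finset.mem_range, seqPrefix_length]
  constructor
  · rintro ⟨-, h, e⟩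
    rw [take_drop_seqPrefix X h] at e
    exact ⟨by omega, e⟩
  · rintro ⟨h, e⟩
    have h' : i + u.length ≤ m + u.length := by omega
    exact ⟨by omega, h', by rwa [take_drop_seqPrefix X h']⟩

open Classical in
lemma HasFreq.tendsto_window {u : List A} {c : ℝ} {X : ℕ → A} (h : HasFreq u X c) :
    Tendsto (fun n : ℕ => (∑ i ∈ Finset.range n,
      if window X i u.length = u then (1 : ℝ) else 0) / n) atTop (𝓝 c) := by
  -- A prefix of length `n + 1 + u.length` has `n + 2` starting positions for `u`, so after these
  -- shifts the two quotients are equal.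
  rw [← tendsto_add_atTop_iff_nat 2]
  refine ((tendsto_add_atTop_iff_nat u.length).2 h).congr fun n => ?_
  rw [wordFreq, show n + u.length + 1 = (n + 1) + u.length by ring, nbOcc_seqPrefix,
    seqPrefix_length]
  push_cast
  congr 1
  ring

end Window

lemma wordProb_pos {A : Type*} {μ : A → ℝ} (hμ : ∀ a, 0 < μ a) (w : List A) : 0 < wordProb μ w :=
  List.prod_pos fun x hx => by
    obtain ⟨a, -, rfl⟩ := List.mem_map.1 hx
    exact hμ a

/-- Every word occurs in a normal sequence. -/
lemma IsNormalSeq.exists_window_eq {A : Type*} {μ : A → ℝ} {X : ℕ → A}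
    (hX : IsNormalSeq μ X) (hμ : ∀ a, 0 < μ a) (w : List A) : ∃ i, window X i w.length = w := by
  classical
  by_contra! hne
  have h := (hX w).tendsto_window
  simp only [hne, if_false, Finset.sum_const_zero, zero_div] at h
  exact (wordProb_pos hμ w).ne (tendsto_nhds_unique tendsto_const_nhds h)

/-! ### Bernoulli expectations as limits of window averages -/

section Expectation

variable {A : Type*} [Fintype A] {μ : A → ℝ}

lemma wordExp_mono (hμ : ∀ a, 0 < μ a) {L : ℕ} {F G : List A → ℝ} (h : ∀ w, F w ≤ G w) :
    wordExp μ L F ≤ wordExp μ L G := by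
  induction L generalizing F G with
  | zero => exact h []
  | succ L ih =>
    exact Finset.sum_le_sum fun a _ => mul_le_mul_of_nonneg_left (ih fun w => h _) (hμ a).le

lemma wordExp_add (L : ℕ) (F G : List A → ℝ) :
    wordExp μ L (fun w => F w + G w) = wordExp μ L F + wordExp μ L G := by
  induction L generalizing F G with
  | zero => rfl
  | succ L ih => simp only [wordExp, ih, mul_add, Finset.sum_add_distrib]

lemma wordExp_mul (L : ℕ) (c : ℝ) (F : List A → ℝ) :
    wordExp μ L (fun w => c * F w) = c * wordExp μ L F := by
  induction L generalizing F with
  | zero => rfl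
  | succ L ih =>
    simp only [wordExp, ih, Finset.mul_sum]
    exact Finset.sum_congr rfl fun a _ => by ring

lemma wordExp_const (hμ : ∑ a, μ a = 1) (L : ℕ) (c : ℝ) :
    wordExp μ L (fun _ => c) = c := by
  induction L with
  | zero => rfl
  | succ L ih => simp only [wordExp, ih, ← Finset.sum_mul, hμ, one_mul]

lemma wordExp_sum {ι : Type*} (s : Finset ι) (L : ℕ) (F : ι → List A → ℝ) :
    wordExp μ L (fun w => ∑ i ∈ s, F i w) = ∑ i ∈ s, wordExp μ L (F i) := by
  classical
  induction L generalizing F with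
  | zero => rfl
  | succ L ih =>
    simp only [wordExp, ih, Finset.mul_sum]
    exact Finset.sum_comm

open Classical in
/-- Along a normal sequence, averages over positions where `u` occurs of a function of the next
`L` letters converge. -/
lemma IsNormalSeq.tendsto_average_after {X : ℕ → A} (hX : IsNormalSeq μ X) (L : ℕ) :
    ∀ (u : List A) (F : List A → ℝ),
      Tendsto (fun n : ℕ => (∑ i ∈ Finset.range n,
        if window X i u.length = u then F (window X (i + u.length) L) else 0) / n) atTop
        (𝓝 (wordProb μ u * wordExp μ L F)) := by
  induction L with
  | zero =>
    intro u F
    refine ((hX u).tendsto_window.mul_const (F [])).congr fun n => ?_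
    rw [div_mul_eq_mul_div, Finset.sum_mul]
    simp [window]
  | succ L ih =>
    intro u F
    -- Split by the letter following `u`: an occurrence of `u` followed by `a` is one of `u ++ [a]`,
    -- which is why `u` varies in the induction.
    have key := tendsto_finsetSum Finset.univ
      fun a _ => ih (u ++ [a]) (fun w => F (a :: w))
    have e : ∑ a, wordProb μ (u ++ [a]) * wordExp μ L (fun w => F (a :: w))
        = wordProb μ u * wordExp μ (L + 1) F := by
      simp [wordProb, wordExp, Finset.mul_sum, mul_assoc]
    rw [e] at key
    refine key.congr fun n => ?_
    rw [← Finset.sum_div, Finset.sum_comm]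
    congr 1
    refine Finset.sum_congr rfl fun i _ => ?_
    simp only [List.length_append, List.length_singleton, window_succ',
      List.append_eq_append_iff_of_size_eq_left (window_length X i u.length)]
    rw [← window_succ', window]
    by_cases hw : window X i u.length = u
    · rw [Finset.sum_eq_single (X (i + u.length))]
      · simp [hw, add_assoc]
      · intro b _ hb
        simp [hb.symm]
      · simp
    · simp [hw]

lemma IsNormalSeq.tendsto_average {X : ℕ → A} (hX : IsNormalSeq μ X) (L : ℕ)
    (F : List A → ℝ) :
    Tendsto (fun n : ℕ => (∑ i ∈ Finset.range n, F (window X i L)) / n) atTop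
      (𝓝 (wordExp μ L F)) := by
  simpa [window, wordProb] using hX.tendsto_average_after L [] F

end Expectation

namespace DetAutomaton

/-! ### Runs and transient states -/

section Runs

variable {Q A : Type*} (M : DetAutomaton Q A) (X : ℕ → A)

lemma stepWord_append (p : Q) (u v : List A) :
    M.stepWord p (u ++ v) = M.stepWord (M.stepWord p u) v := by
  simp [stepWord]

lemma run_add (i k : ℕ) : M.run X (i + k) = M.stepWord (M.run X i) (window X i k) := by
  simp only [run, seqPrefix_add, stepWord_append]

lemma run_succ (i : ℕ) : M.run X (i + 1) = M.step (M.run X i) (X i) := by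
  rw [run_add]
  simp [window, stepWord]

lemma runSum_window (f : Q → ℝ) (i L : ℕ) :
    M.runSum f (M.run X i) (window X i L) = ∑ j ∈ Finset.range L, f (M.run X (i + j)) := by
  induction L generalizing i with
  | zero => rfl
  | succ L ih =>
    rw [window, runSum, ← run_succ, ih, Finset.sum_range_succ', add_comm]
    simp only [add_zero]
    congr 1
    exact Finset.sum_congr rfl fun j _ => by congr 2; ring

lemma visits_eq_of_not_visited {q : Q} {N : ℕ} (h : ∀ i, N < i → M.run X i ≠ q) {n : ℕ}
    (hn : N ≤ n) : M.visits q n X = M.visits q N X := by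
  unfold visits
  congr 1
  ext i
  simp only [Finset.mem_filter, Finset.mem_range]
  constructor
  · rintro ⟨-, e⟩
    refine ⟨?_, e⟩
    by_contra hi
    exact h i (by omega) e
  · rintro ⟨hi, e⟩
    exact ⟨by omega, e⟩

open Classical in
lemma visits_eq_sum (q : Q) (n : ℕ) :
    (M.visits q n X : ℝ) = ∑ i ∈ Finset.range (n + 1), if M.run X i = q then (1 : ℝ) else 0 := by
  rw [← Finset.sum_filter, Finset.sum_const, nsmul_eq_mul, mul_one]
  rfl

/-- If from every state some word leads to a closed set of states, then some word leads there
from all states simultaneously. -/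
lemma exists_word_forall [Finite Q] (D : Q → Prop) (hclosed : ∀ p, D p → ∀ w, D (M.stepWord p w))
    (hreach : ∀ p, ∃ w, D (M.stepWord p w)) : ∃ w, ∀ p, D (M.stepWord p w) := by
  classical
  have := Fintype.ofFinite Q
  have key : ∀ s : Finset Q, ∃ w, ∀ p ∈ s, D (M.stepWord p w) := by
    intro s
    induction s using Finset.induction_on with
    | empty => exact ⟨[], by simp⟩
    | insert p s _ ih =>
      obtain ⟨w, hw⟩ := ih
      obtain ⟨v, hv⟩ := hreach (M.stepWord p w)
      refine ⟨w ++ v, fun r hr => ?_⟩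
      rw [stepWord_append]
      rcases Finset.mem_insert.1 hr with rfl | hr
      · exact hv
      · exact hclosed _ (hw r hr) v
  obtain ⟨w, hw⟩ := key Finset.univ
  exact ⟨w, fun p => hw p (Finset.mem_univ p)⟩

/-- A normal sequence visits a transient state only finitely often. -/
lemma finite_visits_of_transient [Finite Q] [Fintype A] {μ : A → ℝ} (hμ : ∀ a, 0 < μ a)
    (hX : IsNormalSeq μ X) {q : Q} {v : List A}
    (hv : ∀ u, M.stepWord (M.stepWord q v) u ≠ q) :
    ∃ N, ∀ i, N < i → M.run X i ≠ q := by
  obtain ⟨w, hw⟩ := M.exists_word_forall (fun p => ∀ u, M.stepWord p u ≠ q)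
    (fun p hp w u => by rw [← stepWord_append]; exact hp _)
    (fun p => by
      by_cases hp : ∃ u, M.stepWord p u = q
      · obtain ⟨u, hu⟩ := hp
        exact ⟨u ++ v, by rw [stepWord_append, hu]; exact hv⟩
      · push Not at hp
        exact ⟨[], hp⟩)
  obtain ⟨i, hi⟩ := hX.exists_window_eq hμ w
  refine ⟨i + w.length, fun j hj => ?_⟩
  obtain ⟨d, rfl⟩ := Nat.exists_eq_add_of_le hj.le
  rw [run_add, run_add, hi]
  exact hw _ _

end Runs

/-! ### Irreducible chains and the Poisson equation -/

section Poisson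

variable {S A : Type*} [Fintype A] {μ : A → ℝ} (M : DetAutomaton S A)

/-- Minimum principle: superharmonic functions of an irreducible finite chain are constant. -/
lemma eq_of_superharmonic [Finite S] (hμ : ∀ a, 0 < μ a) (hμ1 : ∑ a, μ a = 1)
    (hconn : ∀ p r, ∃ w, M.stepWord p w = r) {h : S → ℝ}
    (hs : ∀ p, ∑ a, μ a * h (M.step p a) ≤ h p) (p r : S) : h p = h r := by
  have : Nonempty S := ⟨p⟩
  obtain ⟨m, hm⟩ := Finite.exists_min h
  have step : ∀ s, h s = h m → ∀ a, h (M.step s a) = h m := by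
    intro s e a
    by_contra hne
    have hlt : ∑ b, μ b * h m < ∑ b, μ b * h (M.step s b) :=
      Finset.sum_lt_sum (fun b _ => mul_le_mul_of_nonneg_left (hm _) (hμ b).le)
        ⟨a, Finset.mem_univ a,
          mul_lt_mul_of_pos_left (lt_of_le_of_ne (hm _) (Ne.symm hne)) (hμ a)⟩
    rw [← Finset.sum_mul, hμ1, one_mul] at hlt
    linarith [hs s]
  have word : ∀ (w : List A) s, h s = h m → h (M.stepWord s w) = h m := by
    intro w
    induction w with
    | nil => exact fun s e => e
    | cons a w ih => exact fun s e => ih _ (step s e a)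
  have all : ∀ s, h s = h m := by
    intro s
    obtain ⟨w, rfl⟩ := hconn m s
    exact word w m rfl
  rw [all p, all r]

/-- The Poisson equation for the indicator of a state of an irreducible finite chain. -/
lemma exists_poisson_of_connected [Finite S] [DecidableEq S] (hμ : ∀ a, 0 < μ a)
    (hμ1 : ∑ a, μ a = 1) (hconn : ∀ p r, ∃ w, M.stepWord p w = r) (q : S) :
    ∃ (c : ℝ) (h : S → ℝ), 0 < c ∧
      ∀ p, h p - ∑ a, μ a * h (M.step p a) = (if p = q then 1 else 0) - c := by
  -- The added `h q` removes the constants from the kernel and plays the role of the unknown `c`;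
  -- injectivity then gives surjectivity by finite dimension.
  let Φ : (S → ℝ) →ₗ[ℝ] (S → ℝ) :=
    { toFun := fun h p => h p - ∑ a, μ a * h (M.step p a) + h q
      map_add' := fun h g => by
        ext p
        simp only [Pi.add_apply, mul_add, Finset.sum_add_distrib]
        ring
      map_smul' := fun c h => by
        ext p
        simp only [Pi.smul_apply, smul_eq_mul, RingHom.id_apply, mul_add, mul_sub,
          Finset.mul_sum, mul_left_comm] }
  have aux : ∀ h : S → ℝ, Φ h = 0 → h q ≤ 0 → h = 0 := by
    intro h e hq
    have hp : ∀ p, h p - ∑ a, μ a * h (M.step p a) + h q = 0 := fun p => congrFun e p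
    have hc := M.eq_of_superharmonic hμ hμ1 hconn (h := h) (fun p => by linarith [hp p])
    have hq0 := hp q
    rw [Finset.sum_congr rfl fun a _ => by rw [hc (M.step q a) q], ← Finset.sum_mul, hμ1] at hq0
    ext p
    rw [hc p q, Pi.zero_apply]
    linarith
  have inj : Function.Injective Φ := by
    rw [injective_iff_map_eq_zero]
    intro h e
    rcases le_total (h q) 0 with hq | hq
    · exact aux h e hq
    · exact neg_eq_zero.1 (aux (-h) (by rw [map_neg, e, neg_zero]) (by simpa using hq))
  obtain ⟨h, hh⟩ := (LinearMap.injective_iff_surjective.1 inj) (fun p => if p = q then 1 else 0)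
  have hp : ∀ p, h p - ∑ a, μ a * h (M.step p a) + h q = if p = q then 1 else 0 :=
    fun p => congrFun hh p
  refine ⟨h q, h, ?_, fun p => by linarith [hp p]⟩
  -- If `h q ≤ 0` then `h` is superharmonic, hence constant, and the equation at `q` reads `h q =
  -- 1`.
  by_contra! hle
  have hc := M.eq_of_superharmonic hμ hμ1 hconn (h := h) (fun p => by
    have h1 := hp p
    split_ifs at h1 <;> linarith)
  have hq0 := hp q
  rw [Finset.sum_congr rfl fun a _ => by rw [hc (M.step q a) q], ← Finset.sum_mul, hμ1,
    if_pos rfl] at hq0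
  linarith

/-- The Poisson equation on the class of a recurrent state. -/
lemma exists_poisson [Finite S] [DecidableEq S] (hμ : ∀ a, 0 < μ a)
    (hμ1 : ∑ a, μ a = 1) {q : S} (hrec : ∀ v, ∃ u, M.stepWord (M.stepWord q v) u = q) :
    ∃ (c : ℝ) (h : S → ℝ), 0 < c ∧ ∀ p, (∃ w, M.stepWord q w = p) →
      h p - ∑ a, μ a * h (M.step p a) = (if p = q then 1 else 0) - c := by
  classical
  have hstep : ∀ (p : {p // ∃ w, M.stepWord q w = p}) a,
      ∃ w, M.stepWord q w = M.step p a := by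
    rintro ⟨_, w, rfl⟩ a
    exact ⟨w ++ [a], by rw [stepWord_append]; rfl⟩
  let N : DetAutomaton {p // ∃ w, M.stepWord q w = p} A :=
    ⟨⟨q, [], rfl⟩, fun p a => ⟨M.step p a, hstep p a⟩⟩
  have hN : ∀ (w : List A) p, (N.stepWord p w : S) = M.stepWord p w := by
    intro w
    induction w with
    | nil => exact fun p => rfl
    | cons a w ih => exact fun p => ih (N.step p a)
  obtain ⟨c, h, hc, hh⟩ := N.exists_poisson_of_connected hμ hμ1 (by
    rintro ⟨_, v, rfl⟩ ⟨_, w, rfl⟩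
    obtain ⟨u, hu⟩ := hrec v
    exact ⟨u ++ w, Subtype.ext (by rw [hN, stepWord_append, hu])⟩) ⟨q, [], rfl⟩
  refine ⟨c, fun p => if hp : ∃ w, M.stepWord q w = p then h ⟨p, hp⟩ else 0, hc, fun p hp => ?_⟩
  have key := hh ⟨p, hp⟩
  simp only [Subtype.mk.injEq] at key
  rw [← key]
  simp only [dif_pos hp]
  congr 1
  refine Finset.sum_congr rfl fun a _ => ?_
  rw [dif_pos (hstep ⟨p, hp⟩ a)]

end Poisson

/-! ### Moment bounds for sums along random words -/

section Moments

variable {Q A : Type*} [Fintype A] {μ : A → ℝ} (M : DetAutomaton Q A)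

/-- The martingale property: by the Poisson equation, the first letter leaves the mean of sum plus
`h` unchanged. -/
lemma wordExp_runSum_add (hμ1 : ∑ a, μ a = 1) {f h : Q → ℝ} {C : Q → Prop}
    (hC : ∀ p, C p → ∀ a, C (M.step p a))
    (hp : ∀ p, C p → h p - ∑ a, μ a * h (M.step p a) = f p) (L : ℕ) :
    ∀ p, C p → wordExp μ L (fun w => M.runSum f p w + h (M.stepWord p w)) = h p := by
  induction L with
  | zero => intro p _; simp [wordExp, runSum, stepWord]
  | succ L ih =>
    intro p hpC
    have e : ∀ a, wordExp μ L (fun w => M.runSum f p (a :: w) + h (M.stepWord p (a :: w)))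
        = f p + h (M.step p a) := by
      intro a
      rw [← ih _ (hC p hpC a), ← wordExp_const hμ1 L (f p), ← wordExp_add]
      simp only [runSum, stepWord, List.foldl_cons, add_assoc]
    simp only [wordExp, e, mul_add, Finset.sum_add_distrib, ← Finset.sum_mul, hμ1]
    linarith [hp p hpC]

/-- Expand the square after the first letter; the previous lemma evaluates the cross term, and each
letter costs at most `K`. -/
lemma wordExp_sq_runSum_add_le (hμ : ∀ a, 0 < μ a) (hμ1 : ∑ a, μ a = 1) {f h : Q → ℝ}
    {C : Q → Prop} (hC : ∀ p, C p → ∀ a, C (M.step p a))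
    (hp : ∀ p, C p → h p - ∑ a, μ a * h (M.step p a) = f p) {K : ℝ} (hK : ∀ p, h p ^ 2 ≤ K)
    (L : ℕ) : ∀ p, C p →
      wordExp μ L (fun w => (M.runSum f p w + h (M.stepWord p w)) ^ 2) ≤ h p ^ 2 + L * K := by
  induction L with
  | zero => intro p _; simp [wordExp, runSum, stepWord]
  | succ L ih =>
    intro p hpC
    have e : ∀ a, wordExp μ L
          (fun w => (M.runSum f p (a :: w) + h (M.stepWord p (a :: w))) ^ 2)
        ≤ f p ^ 2 + 2 * f p * h (M.step p a) + (K + L * K) := by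
      intro a
      have h1 := M.wordExp_runSum_add hμ1 hC hp L _ (hC p hpC a)
      have h2 := ih _ (hC p hpC a)
      have h3 : (fun w => (M.runSum f p (a :: w) + h (M.stepWord p (a :: w))) ^ 2)
          = fun w => (f p ^ 2 + 2 * f p *
            (M.runSum f (M.step p a) w + h (M.stepWord (M.step p a) w)))
            + (M.runSum f (M.step p a) w + h (M.stepWord (M.step p a) w)) ^ 2 := by
        ext w
        simp only [runSum, stepWord, List.foldl_cons]
        ring
      rw [h3, wordExp_add, wordExp_add, wordExp_const hμ1, wordExp_mul, h1]
      linarith [hK (M.step p a)]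
    calc wordExp μ (L + 1) (fun w => (M.runSum f p w + h (M.stepWord p w)) ^ 2)
        ≤ ∑ a, μ a * (f p ^ 2 + 2 * f p * h (M.step p a) + (K + L * K)) :=
          Finset.sum_le_sum fun a _ => mul_le_mul_of_nonneg_left (e a) (hμ a).le
      _ = f p ^ 2 + 2 * f p * ∑ a, μ a * h (M.step p a) + (K + L * K) := by
          simp only [mul_add, Finset.sum_add_distrib, ← Finset.sum_mul, hμ1, one_mul,
            Finset.mul_sum, mul_left_comm]
      _ ≤ h p ^ 2 + ((L + 1 : ℕ) : ℝ) * K := by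
          have h4 := hp p hpC
          have h5 : ∑ a, μ a * h (M.step p a) = h p - f p := by linarith
          rw [h5]
          push_cast
          -- `f² + 2f(h - f) = h² - (h - f)²`.
          nlinarith [sq_nonneg (h p - f p)]

/-- Solutions of the Poisson equation give a law of large numbers in mean. -/
lemma exists_wordExp_abs_runSum_le [Fintype Q] (hμ : ∀ a, 0 < μ a) (hμ1 : ∑ a, μ a = 1)
    {f h : Q → ℝ} (C : Q → Prop) [DecidablePred C] (hC : ∀ p, C p → ∀ a, C (M.step p a))
    (hp : ∀ p, C p → h p - ∑ a, μ a * h (M.step p a) = f p) {ε : ℝ} (hε : 0 < ε) :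
    ∃ L : ℕ, 0 < L ∧
      wordExp μ L (fun w => ∑ p with C p, |M.runSum f p w|) ≤ ε * L := by
  set H : ℝ := ∑ p, |h p| with hH
  have hle : ∀ p, |h p| ≤ H := fun p =>
    Finset.single_le_sum (f := fun p => |h p|) (fun _ _ => abs_nonneg _) (Finset.mem_univ p)
  have hH0 : 0 ≤ H := Finset.sum_nonneg fun _ _ => abs_nonneg _
  have hK : ∀ p, h p ^ 2 ≤ H ^ 2 := fun p => sq_le_sq' (neg_le_of_abs_le (hle p))
    (le_of_abs_le (hle p))
  set D : ℝ := H + 1 + 2 * H ^ 2 with hD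
  -- With `L = m ^ 2` each state contributes at most `D * m`, so `card Q * D ≤ ε * m` suffices.
  obtain ⟨m, hm⟩ := exists_nat_gt (Fintype.card Q * D / ε)
  have hm0 : (0 : ℝ) < m := lt_of_le_of_lt (by positivity) hm
  have hm1 : (1 : ℝ) ≤ m := by exact_mod_cast Nat.one_le_iff_ne_zero.2 (by rintro rfl; simp at hm0)
  refine ⟨m ^ 2, by have : 0 < m := by exact_mod_cast hm0
                    positivity, ?_⟩
  have each : ∀ p, C p → wordExp μ (m ^ 2) (fun w => |M.runSum f p w|) ≤ D * m := by
    intro p hpC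
    have h2 := M.wordExp_sq_runSum_add_le hμ hμ1 hC hp hK (m ^ 2) p hpC
    have pt : ∀ w, |M.runSum f p w|
        ≤ (H + m) + (m : ℝ)⁻¹ * (M.runSum f p w + h (M.stepWord p w)) ^ 2 := by
      intro w
      set x := M.runSum f p w + h (M.stepWord p w) with hx
      have h3 : |M.runSum f p w| ≤ |x| + H := by
        have : M.runSum f p w = x - h (M.stepWord p w) := by rw [hx]; ring
        rw [this]
        exact (abs_sub _ _).trans (by linarith [hle (M.stepWord p w)])
      -- This pointwise bound replaces Cauchy–Schwarz.
      have h4 : |x| ≤ m + (m : ℝ)⁻¹ * x ^ 2 := by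
        rw [← sub_nonneg, show (m : ℝ) + (m : ℝ)⁻¹ * x ^ 2 - |x|
          = (m : ℝ)⁻¹ * (m ^ 2 + |x| ^ 2 - m * |x|) by rw [sq_abs]; field_simp]
        exact mul_nonneg (by positivity) (by nlinarith [sq_nonneg ((m : ℝ) - |x|), abs_nonneg x])
      linarith
    calc wordExp μ (m ^ 2) (fun w => |M.runSum f p w|)
        ≤ (H + m) + (m : ℝ)⁻¹ *
          wordExp μ (m ^ 2) (fun w => (M.runSum f p w + h (M.stepWord p w)) ^ 2) := by
          rw [← wordExp_mul, ← wordExp_const hμ1 (m ^ 2) (H + m), ← wordExp_add]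
          exact wordExp_mono hμ pt
      _ ≤ (H + m) + (m : ℝ)⁻¹ * (H ^ 2 + (m : ℝ) ^ 2 * H ^ 2) := by
          push_cast at h2
          gcongr
          linarith [hK p]
      _ ≤ (H * m + m) + (m : ℝ)⁻¹ * ((m : ℝ) ^ 2 * H ^ 2 + (m : ℝ) ^ 2 * H ^ 2) := by
          gcongr
          · nlinarith
          · exact le_mul_of_one_le_left (sq_nonneg H) (one_le_pow₀ hm1)
      _ = D * m := by rw [hD]; field_simp; ring
  rw [wordExp_sum]
  calc ∑ p with C p, wordExp μ (m ^ 2) (fun w => |M.runSum f p w|)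
      ≤ ∑ p with C p, D * m :=
        Finset.sum_le_sum fun p hpm => each p (Finset.mem_filter.1 hpm).2
    _ ≤ ∑ p : Q, D * m :=
        Finset.sum_le_sum_of_subset_of_nonneg (Finset.subset_univ _)
          fun _ _ _ => by positivity
    _ = Fintype.card Q * D * m := by simp [mul_assoc]
    _ ≤ ε * ((m ^ 2 : ℕ) : ℝ) := by
        rw [div_lt_iff₀ hε] at hm
        push_cast
        nlinarith

end Moments

end DetAutomaton

/-! ### From windows to averages along the run -/

lemma abs_sum_shift_sub_le {g : ℕ → ℝ} {B : ℝ} (hB : ∀ i, |g i| ≤ B) (n j : ℕ) :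
    |∑ i ∈ Finset.range n, g i - ∑ i ∈ Finset.range n, g (i + j)| ≤ 2 * B * j := by
  induction j with
  | zero => simp
  | succ j ih =>
    have e : ∑ i ∈ Finset.range n, g (i + (j + 1))
        = ∑ i ∈ Finset.range n, g (i + j) + g (n + j) - g j := by
      have h1 := Finset.sum_range_succ (fun i => g (i + j)) n
      have h2 := Finset.sum_range_succ' (fun i => g (i + j)) n
      simp only [zero_add, show ∀ i, i + 1 + j = i + (j + 1) from fun i => by ring] at h2
      linarith
    rw [e]
    have h1 := abs_le.1 ih
    have h2 := abs_le.1 (hB (n + j))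
    have h3 := abs_le.1 (hB j)
    push_cast
    exact abs_le.2 ⟨by linarith, by linarith⟩

/-- A bounded sequence whose averages over windows of some length are small in mean has averages
tending to zero. -/
lemma tendsto_average_zero_of_windows {g : ℕ → ℝ} {B : ℝ} (hB : ∀ i, |g i| ≤ B)
    (h : ∀ ε > 0, ∃ L : ℕ, 0 < L ∧ ∀ᶠ n : ℕ in atTop,
      (∑ i ∈ Finset.range n, |∑ j ∈ Finset.range L, g (i + j)|) / n ≤ ε * L) :
    Tendsto (fun n : ℕ => (∑ i ∈ Finset.range n, g i) / n) atTop (𝓝 0) := by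
  have hB0 : 0 ≤ B := (abs_nonneg _).trans (hB 0)
  rw [Metric.tendsto_nhds]
  intro ε hε
  obtain ⟨L, hL, hev⟩ := h (ε / 2) (by positivity)
  have hL' : (0 : ℝ) < L := by exact_mod_cast hL
  have hsmall : ∀ᶠ n : ℕ in atTop, 2 * B * L / n < ε / 2 :=
    (tendsto_const_div_atTop_nhds_zero_nat (2 * B * L)).eventually_lt_const (by positivity)
  filter_upwards [hev, hsmall, eventually_gt_atTop 0] with n h1 h2 hn
  have hn' : (0 : ℝ) < n := by exact_mod_cast hn
  rw [Real.dist_eq, sub_zero, abs_div, abs_of_pos hn', div_lt_iff₀ hn']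
  rw [div_le_iff₀ hn'] at h1
  rw [div_lt_iff₀ hn'] at h2
  have e : (L : ℝ) * ∑ i ∈ Finset.range n, g i
      = ∑ j ∈ Finset.range L,
          (∑ i ∈ Finset.range n, g i - ∑ i ∈ Finset.range n, g (i + j))
        + ∑ i ∈ Finset.range n, ∑ j ∈ Finset.range L, g (i + j) := by
    rw [Finset.sum_sub_distrib, Finset.sum_comm (s := Finset.range n)]
    simp
  have h3 : |∑ j ∈ Finset.range L,
      (∑ i ∈ Finset.range n, g i - ∑ i ∈ Finset.range n, g (i + j))| ≤ L * (2 * B * L) := by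
    refine (Finset.abs_sum_le_sum_abs _ _).trans ?_
    calc _ ≤ ∑ j ∈ Finset.range L, 2 * B * (L : ℝ) :=
          Finset.sum_le_sum fun j hj => (abs_sum_shift_sub_le hB n j).trans (by
            have : (j : ℝ) ≤ L := by exact_mod_cast (Finset.mem_range.1 hj).le
            gcongr)
      _ = _ := by simp
  have h4 := Finset.abs_sum_le_sum_abs
    (fun i => ∑ j ∈ Finset.range L, g (i + j)) (Finset.range n)
  have h5 : (L : ℝ) * |∑ i ∈ Finset.range n, g i| < L * (ε * n) := by
    rw [← abs_of_pos hL', ← abs_mul, abs_of_pos hL', e]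
    refine (abs_add_le _ _).trans_lt ?_
    nlinarith [mul_lt_mul_of_pos_left h2 hL']
  exact lt_of_mul_lt_mul_left h5 hL'.le

/-- On a normal sequence that visits a recurrent state, the deviation of visits averages to
zero. -/
lemma DetAutomaton.tendsto_average_run {Q A : Type*} [Fintype Q] [Fintype A]
    (M : DetAutomaton Q A) {μ : A → ℝ} (hμ : ∀ a, 0 < μ a) (hμ1 : ∑ a, μ a = 1) {f h : Q → ℝ}
    {C : Q → Prop} (hC : ∀ p, C p → ∀ a, C (M.step p a))
    (hp : ∀ p, C p → h p - ∑ a, μ a * h (M.step p a) = f p) {X : ℕ → A}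
    (hX : IsNormalSeq μ X) {k : ℕ} (hk : C (M.run X k)) :
    Tendsto (fun n : ℕ => (∑ i ∈ Finset.range n, f (M.run X i)) / n) atTop (𝓝 0) := by
  classical
  have hrun : ∀ i, k ≤ i → C (M.run X i) := by
    intro i hi
    induction i, hi using Nat.le_induction with
    | base => exact hk
    | succ i _ ih => rw [run_succ]; exact hC _ ih _
  set B : ℝ := ∑ p, |f p| with hBdef
  have hB : ∀ i, |f (M.run X i)| ≤ B := fun i =>
    Finset.single_le_sum (f := fun p => |f p|) (fun _ _ => abs_nonneg _) (Finset.mem_univ _)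
  have hB0 : 0 ≤ B := (abs_nonneg _).trans (hB 0)
  refine tendsto_average_zero_of_windows hB fun ε hε => ?_
  obtain ⟨L, hL, hE⟩ := M.exists_wordExp_abs_runSum_le hμ hμ1 C hC hp (half_pos hε)
  refine ⟨L, hL, ?_⟩
  have hL' : (0 : ℝ) < L := by exact_mod_cast hL
  set F : List A → ℝ := fun w => ∑ p with C p, |M.runSum f p w| with hF
  have hF0 : ∀ w, 0 ≤ F w := fun w => Finset.sum_nonneg fun _ _ => abs_nonneg _
  -- Before time `k` the run may lie outside `C`; those positions get a crude bound, negligible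
  -- after division by `n`.
  have h1 : ∀ i, |∑ j ∈ Finset.range L, f (M.run X (i + j))|
      ≤ F (window X i L) + if i < k then L * B else 0 := by
    intro i
    split_ifs with hi
    · have : |∑ j ∈ Finset.range L, f (M.run X (i + j))| ≤ L * B :=
        (Finset.abs_sum_le_sum_abs _ _).trans
          ((Finset.sum_le_sum fun j _ => hB (i + j)).trans (by simp))
      linarith [hF0 (window X i L)]
    · rw [add_zero, ← runSum_window]
      exact Finset.single_le_sum (f := fun p => |M.runSum f p (window X i L)|)
        (fun _ _ => abs_nonneg _)
        (Finset.mem_filter.2 ⟨Finset.mem_univ _, hrun i (by omega)⟩)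
  have h2 : ∀ n, ∑ i ∈ Finset.range n, (if i < k then (L : ℝ) * B else 0) ≤ k * (L * B) := by
    intro n
    rw [← Finset.sum_filter, Finset.sum_const, nsmul_eq_mul]
    gcongr
    calc _ ≤ (Finset.range k).card := Finset.card_le_card fun i hi => by
            simpa using (Finset.mem_filter.1 hi).2
      _ = k := Finset.card_range k
  have h3 := (hX.tendsto_average L F).add
    (tendsto_const_div_atTop_nhds_zero_nat ((k : ℝ) * (L * B)))
  rw [add_zero] at h3
  have h4 : wordExp μ L F < ε * L := lt_of_le_of_lt hE (by nlinarith [mul_pos hε hL'])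
  filter_upwards [h3.eventually_lt_const h4] with n hn
  refine le_trans ?_ hn.le
  rw [← add_div]
  gcongr
  calc _ ≤ ∑ i ∈ Finset.range n, (F (window X i L) + if i < k then L * B else 0) :=
        Finset.sum_le_sum fun i _ => h1 i
    _ ≤ _ := by
        rw [Finset.sum_add_distrib]
        linarith [h2 n]

theorem mainTheorem8 {Q A : Type*} [Fintype Q] [Fintype A] (M : DetAutomaton Q A)
    (μ : A → ℝ) (hμ_pos : ∀ a, 0 < μ a) (hμ_sum : ∑ a, μ a = 1) :
    ∀ q : Q, ∃ π : ℝ, 0 ≤ π ∧ ∀ X : ℕ → A, IsNormalSeq μ X →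
      (∃ N : ℕ, ∀ n : ℕ, N ≤ n → M.visits q n X = M.visits q N X) ∨
      (Filter.Tendsto (fun n : ℕ => (M.visits q n X : ℝ) / (n : ℝ)) Filter.atTop (nhds π) ∧
        0 < π) := by
  classical
  intro q
  by_cases hrec : ∀ v, ∃ u, M.stepWord (M.stepWord q v) u = q
  · obtain ⟨c, h, hc, hh⟩ := M.exists_poisson hμ_pos hμ_sum hrec
    refine ⟨c, hc.le, fun X hX => ?_⟩
    by_cases hvis : ∃ k, M.run X k = q
    · obtain ⟨k, hk⟩ := hvis
      refine Or.inr ⟨?_, hc⟩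
      have key := M.tendsto_average_run hμ_pos hμ_sum (C := fun p => ∃ w, M.stepWord q w = p)
        (by rintro _ ⟨w, rfl⟩ a
            exact ⟨w ++ [a], by rw [M.stepWord_append]; rfl⟩) hh hX (k := k) ⟨[], hk.symm⟩
      -- `visits` counts `n + 1` states but is divided by `n`; this is the extra term.
      have hone : Tendsto (fun n : ℕ => (if M.run X n = q then (1 : ℝ) else 0) / n)
          atTop (𝓝 0) := by
        refine squeeze_zero (fun n => by positivity) (fun n => ?_)
          (tendsto_const_div_atTop_nhds_zero_nat 1)
        gcongr
        split_ifs <;> norm_num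
      have hsum := (key.add hone).add_const c
      rw [add_zero, zero_add] at hsum
      refine hsum.congr' ?_
      filter_upwards [eventually_gt_atTop 0] with n hn
      have hn' : (n : ℝ) ≠ 0 := by exact_mod_cast hn.ne'
      rw [M.visits_eq_sum, Finset.sum_range_succ, Finset.sum_sub_distrib, Finset.sum_const,
        Finset.card_range, nsmul_eq_mul]
      field_simp
      ring
    · push Not at hvis
      exact Or.inl ⟨0, fun n hn => M.visits_eq_of_not_visited X (fun i _ => hvis i) hn⟩
  · push Not at hrec
    obtain ⟨v, hv⟩ := hrec
    refine ⟨0, le_rfl, fun X hX => Or.inl ?_⟩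
    obtain ⟨N, hN⟩ := M.finite_visits_of_transient X hμ_pos hX hv
    exact ⟨N, fun n hn => M.visits_eq_of_not_visited X hN hn⟩
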